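/- Let $k\ge 2$ and let $I_1,\dots,I_k$ (inputs) and $O_1,\dots,O_k$ (outputs) be finite sets. A correlation is a real-valued function $p(a_1\dots a_k\,|\,x_1\dots x_k)$ of $x_i\in I_i$, $a_i\in O_i$. A \emph{sequential C*-algebraic strategy} consists of (1) unital C*-algebras $\mathscr A_1,\dots,\mathscr A_{k-1}$; (2) positive linear functionals $\phi_{a_1|x_1}:\mathscr A_1\to\mathbb C$ such that $\sum_{a_1}\phi_{a_1|x_1}$ is a state for each $x_1\in I_1$; (3) for $2\le j\le k-1$, completely positive maps $T^{(j)}_{a_j|x_j}:\mathscr A_j\to\mathscr A_{j-1}$ such that $\sum_{a_j}T^{(j)}_{a_j|x_j}$ is unital for each $x_j\in I_j$; (4) positive elements $m_{a_k|x_k}\in\mathscr A_{k-1}$ with $\sum_{a_k}m_{a_k|x_k}=1$ for each $x_k\in I_k$. It produces the correlation $$p(a_1\dots a_k|x_1\dots x_k)=\phi_{a_1|x_1}\circ T^{(2)}_{a_2|x_2}\circ\dots\circ T^{(k-1)}_{a_{k-1}|x_{k-1}}(m_{a_k|x_k}).$$ The strategy is \emph{operationally non-signalling} if there is a state $\phi$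 on $\mathscr A_1$ with $\sum_{a_1}\phi_{a_1|x_1}=\phi$ for all $x_1$, and for each $2\le j\le k-1$ there is a unital completely positive map $T^{(j)}:\mathscr A_j\to\mathscr A_{j-1}$ with $\sum_{a_j}T^{(j)}_{a_j|x_j}=T^{(j)}$ for all $x_j$. A \emph{commuting-operator strategy} consists of a complex Hilbert space $H$, for each player $i$ and input $x_i\in I_i$ a POVM $(M^{(i)}_{a_i|x_i})_{a_i\in O_i}$ on $H$, such that operators of different players commute, and a unit vector $\psi\in H$. It produces the correlation $$p(a_1\dots a_k|x_1\dots x_k)=\langle\psi|\,M^{(1)}_{a_1|x_1}\cdots M^{(k)}_{a_k|x_k}\,|\psi\rangle.$$ \textbf{Theorem.} For every $k\ge 2$ and all finite sets $I_i$, $O_i$, the set of correlations produced by operationally non-signalling sequential C*-algebraic strategies is equal to the set of correlations produced by commuting-operator strategies. -/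

import Mathlib

open scoped ComplexOrder CStarAlgebra InnerProductSpace

universe u v w

namespace SeqGames

/-! Throughout there are `n + 2` players, indexed by `Fin (n + 2)`; player `i` has the input
labels `I i` and the output labels `O i`. -/

/-- A correlation: the real number `p x a` is `p(a₁ … aₖ | x₁ … xₖ)`. -/
abbrev Correlation {n : ℕ} (I : Fin (n + 2) → Type v) (O : Fin (n + 2) → Type w) :
    Type (max v w) :=
  (∀ i, I i) → (∀ i, O i) → ℝ

/-! ### Sequential C*-algebraic strategies -/

/-- A sequential C*-algebraic strategy of `n + 2` players: `n + 1` unital C*-algebras, an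
assemblage prepared by the first player, a transformation for each of the `n` intermediate players
(in the Heisenberg picture, so from the algebra of the following player to the algebra of
the preceding one), and a measurement for the last player.
The maps `φ x a` are automatically sub-normalised and the maps `T j x a` automatically sub-unital,
being summands of a state and of a unital completely positive map, respectively. -/
structure SequentialStrategy {n : ℕ} (I : Fin (n + 2) → Type v) (O : Fin (n + 2) → Type w)
    [∀ i, Fintype (O i)] where
  /-- the C*-algebras -/
  𝒜 : Fin (n + 1) → Type u
  [cstarAlgebra : ∀ i, CStarAlgebra (𝒜 i)]
  [partialOrder : ∀ i, PartialOrder (𝒜 i)]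
  [starOrderedRing : ∀ i, StarOrderedRing (𝒜 i)]
  /-- the positive functionals prepared by the first player -/
  φ : I 0 → O 0 → (𝒜 0 →ₚ[ℂ] ℂ)
  /-- for each input, the assemblage sums up to a state -/
  φ_sum_one : ∀ x, ∑ a, φ x a 1 = 1
  /-- the completely positive maps of the intermediate player `j + 1` -/
  T : ∀ j : Fin n, I j.succ.castSucc → O j.succ.castSucc → (𝒜 j.succ →CP 𝒜 j.castSucc)
  /-- for each input, the transformation sums up to a unital map -/
  T_sum_one : ∀ j x, ∑ a, T j x a 1 = 1
  /-- the measurement operators of the last player -/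
  m : I (Fin.last (n + 1)) → O (Fin.last (n + 1)) → 𝒜 (Fin.last n)
  m_nonneg : ∀ x a, 0 ≤ m x a
  m_sum : ∀ x, ∑ a, m x a = 1

attribute [instance] SequentialStrategy.cstarAlgebra SequentialStrategy.partialOrder
  SequentialStrategy.starOrderedRing

namespace SequentialStrategy

variable {n : ℕ} {I : Fin (n + 2) → Type v} {O : Fin (n + 2) → Type w} [∀ i, Fintype (O i)]

/-- Starting from the measurement operator of the last player, apply the maps of the intermediate
players one after the other, down to the algebra `𝒜 i`. At `i = 0` this is
`T_{a₂|x₂} ∘ ⋯ ∘ T_{aₖ₋₁|xₖ₋₁} (m_{aₖ|xₖ})`. -/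
noncomputable def effect (S : SequentialStrategy.{u} I O) (x : ∀ i, I i) (a : ∀ i, O i) (i : Fin (n + 1)) :
    S.𝒜 i :=
  Fin.reverseInduction (motive := S.𝒜) (S.m (x (Fin.last (n + 1))) (a (Fin.last (n + 1))))
    (fun j g => S.T j (x j.succ.castSucc) (a j.succ.castSucc) g) i

/-- The value `φ_{a₁|x₁} ∘ T_{a₂|x₂} ∘ ⋯ ∘ T_{aₖ₋₁|xₖ₋₁} (m_{aₖ|xₖ})`. -/
noncomputable def value (S : SequentialStrategy.{u} I O) (x : ∀ i, I i) (a : ∀ i, O i) : ℂ :=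
  S.φ (x 0) (a 0) (S.effect x a 0)

/-- The assemblage of the first player is operationally non-signalling: its sum over the output
is one and the same state for all inputs. -/
def IsOpNonSignallingAssemblage (S : SequentialStrategy.{u} I O) : Prop :=
  ∃ φ₀ : S.𝒜 0 →ₚ[ℂ] ℂ, φ₀ 1 = 1 ∧ ∀ x g, ∑ a, S.φ x a g = φ₀ g

/-- The transformation of the intermediate player `j + 1` is operationally non-signalling: its sum
over the output is one and the same unital completely positive map for all inputs. -/
def IsOpNonSignallingTransformation (S : SequentialStrategy.{u} I O) (j : Fin n) : Prop :=
  ∃ T₀ : S.𝒜 j.succ →CP S.𝒜 j.castSucc, T₀ 1 = 1 ∧ ∀ x g, ∑ a, S.T j x a g = T₀ g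

/-- The strategy is operationally non-signalling. -/
def IsOpNonSignalling (S : SequentialStrategy.{u} I O) : Prop :=
  S.IsOpNonSignallingAssemblage ∧ ∀ j, S.IsOpNonSignallingTransformation j

end SequentialStrategy

/-- The correlations of sequential C*-algebraic strategies whose assemblage and transformations
are operationally non-signalling. -/
def seqOpNSCorrelations {n : ℕ} (I : Fin (n + 2) → Type v) (O : Fin (n + 2) → Type w)
    [∀ i, Fintype (O i)] : Set (Correlation I O) :=
  {p | ∃ S : SequentialStrategy.{u} I O, S.IsOpNonSignalling ∧
    ∀ x a, (p x a : ℂ) = S.value x a}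

/-! ### Commuting-operator strategies -/

/-- A commuting-operator strategy of `n + 2` players: a Hilbert space, pairwise commuting POVMs of
the players, and a unit vector. -/
structure CommutingStrategy {n : ℕ} (I : Fin (n + 2) → Type v) (O : Fin (n + 2) → Type w)
    [∀ i, Fintype (O i)] where
  /-- the Hilbert space -/
  H : Type u
  [normedAddCommGroup : NormedAddCommGroup H]
  [innerProductSpace : InnerProductSpace ℂ H]
  [completeSpace : CompleteSpace H]
  /-- the POVM elements of the players -/
  M : ∀ i, I i → O i → (H →L[ℂ] H)
  M_pos : ∀ i x a, (M i x a).IsPositive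
  M_sum : ∀ i x, ∑ a, M i x a = 1
  M_comm : ∀ i j, i ≠ j → ∀ x a y b, Commute (M i x a) (M j y b)
  /-- the shared state -/
  ψ : H
  norm_ψ : ‖ψ‖ = 1

attribute [instance] CommutingStrategy.normedAddCommGroup CommutingStrategy.innerProductSpace
  CommutingStrategy.completeSpace

/-- The value `⟨ψ| M_{a₁|x₁} ⋯ M_{aₖ|xₖ} |ψ⟩`. -/
noncomputable def CommutingStrategy.value {n : ℕ} {I : Fin (n + 2) → Type v}
    {O : Fin (n + 2) → Type w} [∀ i, Fintype (O i)] (S : CommutingStrategy.{u} I O)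
    (x : ∀ i, I i) (a : ∀ i, O i) : ℂ :=
  ⟪S.ψ, (List.ofFn fun i => S.M i (x i) (a i)).prod S.ψ⟫_ℂ

/-- The correlations of commuting-operator strategies. -/
def commutingCorrelations {n : ℕ} (I : Fin (n + 2) → Type v) (O : Fin (n + 2) → Type w)
    [∀ i, Fintype (O i)] : Set (Correlation I O) :=
  {p | ∃ S : CommutingStrategy.{u} I O, ∀ x a, (p x a : ℂ) = S.value x a}

end SeqGames

/-!
The two sets of correlations are shown to contain each other.

*From commuting operators to sequential strategies.* Let the algebra after player `i` be the
commutant of all measurement operators of the players up to `i`. An intermediate player acts by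
`X ↦ M^{1/2} X M^{1/2} = M X`, which is completely positive (`conjCP`) and lands in the larger
commutant of the players before; the sum over the outcomes is the inclusion of commutants, for every
input. The first player prepares the vector functionals of `M^{1/2} ψ`, which on the commutant of
the `M` sum up to that of `ψ`.

*From sequential strategies to commuting operators.* The players are represented one after the
other (`SequentialStrategy.PartialRealization`). Given a representation of the algebra of the
present stage on `H` whose image commutes with the measurement operators found so far, the
non-signalling sum `Φ₀` of the next player's maps is dilated to the completion `K` of `A ⊗ H` for
the form `⟪x ⊗ ξ, y ⊗ η⟫ = ⟪ξ, Φ₀ (x⋆ y) η⟫` (Stinespring). Because `Φ₀` does not depend on the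
input, the isometry `V : H → K` does not either. The summands `Φ x y` of `Φ₀` give forms dominated
by the inner product, hence positive operators `D x y` commuting with `A` which sum up to `1`
(Radon–Nikodym). Operators on `H` commuting with the range of `Φ₀` and of the `Φ x y` act on
`A ⊗ H` through the second factor; this is a star homomorphism into the operators on `K`,
intertwined by `V`, whose values commute with `A` and with the `D x y`. All of this is
`exists_dilation`. The first step is the case `H = ℂ`, and the last player measures with the
represented operators.
-/

namespace SeqGames

open scoped TensorProduct

/-! ### Hilbert spaces and operators from positive forms -/

/-- A nonnegative sesquilinear form on a complex vector space is Hermitian, by polarization. -/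
lemma isSymm_of_nonneg {E : Type*} [AddCommGroup E] [Module ℂ E]
    (B : E →ₗ⋆[ℂ] E →ₗ[ℂ] ℂ) (hB : ∀ v, 0 ≤ B v v) (v w : E) :
    starRingEnd ℂ (B w v) = B v w := by
  have im (u : E) : (B u u).im = 0 := (Complex.nonneg_iff.1 (hB u)).2.symm
  have h1 := im (v + w)
  have h2 := im (v + Complex.I • w)
  simp [im] at h1 h2
  apply Complex.ext <;> simp <;> linarith

/-- Separation and completion of a vector space with respect to a nonnegative sesquilinear form. -/
lemma exists_hilbert_completion {E : Type u} [AddCommGroup E] [Module ℂ E]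
    (B : E →ₗ⋆[ℂ] E →ₗ[ℂ] ℂ) (hB : ∀ v, 0 ≤ B v v) :
    ∃ (K : Type u) (_ : NormedAddCommGroup K) (_ : InnerProductSpace ℂ K) (_ : CompleteSpace K)
      (j : E →ₗ[ℂ] K), DenseRange j ∧ ∀ v w, ⟪j v, j w⟫_ℂ = B v w := by
  let c : PreInnerProductSpace.Core ℂ E :=
    { inner := fun v w => B v w
      conj_inner_symm := isSymm_of_nonneg B hB
      re_inner_nonneg := fun v => (Complex.nonneg_iff.1 (hB v)).1
      add_left := fun u v w => by simp
      smul_left := fun u v r => by simp }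
  let : SeminormedAddCommGroup E := InnerProductSpace.Core.toSeminormedAddCommGroup (c := c)
  let : InnerProductSpace ℂ E := InnerProductSpace.ofCore c
  refine ⟨UniformSpace.Completion E, inferInstance, inferInstance, inferInstance,
    (UniformSpace.Completion.toComplL (𝕜 := ℂ) (E := E)).toLinearMap,
    UniformSpace.Completion.denseRange_coe, fun v w => ?_⟩
  exact UniformSpace.Completion.inner_coe v w

section Dense

variable {E : Type*} [AddCommGroup E] [Module ℂ E]
  {K : Type*} [NormedAddCommGroup K] [InnerProductSpace ℂ K]
  {j : E →ₗ[ℂ] K}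

lemma clm_ext_of_dense {F : Type*} [NormedAddCommGroup F] [NormedSpace ℂ F] (hj : DenseRange j)
    {f g : K →L[ℂ] F} (h : ∀ v, f (j v) = g (j v)) : f = g :=
  ContinuousLinearMap.coeFn_injective
    (hj.equalizer f.continuous g.continuous (funext h))

lemma clm_ext_inner_of_dense (hj : DenseRange j) {f g : K →L[ℂ] K}
    (h : ∀ v w, ⟪j v, f (j w)⟫_ℂ = ⟪j v, g (j w)⟫_ℂ) : f = g := by
  refine clm_ext_of_dense hj fun w => ?_
  exact hj.eq_of_inner_right (𝕜 := ℂ) fun v => h v w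

lemma exists_clm_of_norm_le {F : Type*} [NormedAddCommGroup F] [NormedSpace ℂ F] [CompleteSpace F]
    (hj : DenseRange j) (f : E →ₗ[ℂ] F) (C : ℝ) (hf : ∀ v, ‖f v‖ ≤ C * ‖j v‖) :
    ∃ g : K →L[ℂ] F, ∀ v, g (j v) = f v :=
  ⟨f.extendOfNorm j, LinearMap.extendOfNorm_eq hj ⟨C, hf⟩⟩

variable [CompleteSpace K]

/-- An action of a C*-algebra on a dense (not necessarily embedded) vector space by formally
adjointable operators is automatically bounded, and extends to a representation. The bound
`‖u v‖ ≤ ‖u‖ ‖v‖` comes from `‖u‖² - u⋆ u` being of the form `c⋆ c`. -/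
lemma exists_starAlgHom_of_action {U : Type*} [CStarAlgebra U] (hj : DenseRange j)
    (L : U →ₐ[ℂ] Module.End ℂ E)
    (hL : ∀ u v w, ⟪j (L u v), j w⟫_ℂ = ⟪j v, j (L (star u) w)⟫_ℂ) :
    ∃ π : U →⋆ₐ[ℂ] (K →L[ℂ] K), ∀ u v, π u (j v) = j (L u v) := by
  let := CStarAlgebra.spectralOrder U
  have := CStarAlgebra.spectralOrderedRing U
  have bound (u : U) (v : E) : ‖j (L u v)‖ ≤ ‖u‖ * ‖j v‖ := by
    obtain ⟨c, hc⟩ := (CStarAlgebra.nonneg_iff_eq_star_mul_self).1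
      (sub_nonneg.2 (CStarAlgebra.star_mul_le_algebraMap_norm_sq (a := u)))
    have key (c : U) : ⟪j (L c v), j (L c v)⟫_ℂ = ⟪j v, j (L (star c * c) v)⟫_ℂ := by
      rw [hL, map_mul]; rfl
    have h : ⟪j (L c v), j (L c v)⟫_ℂ =
        (‖u‖ ^ 2 : ℝ) * ⟪j v, j v⟫_ℂ - ⟪j (L u v), j (L u v)⟫_ℂ := by
      rw [key c, key u, ← hc, map_sub, IsScalarTower.algebraMap_apply ℝ ℂ U, AlgHom.commutes,
        LinearMap.sub_apply, Module.algebraMap_end_apply, map_sub, map_smul, inner_sub_right,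
        inner_smul_right]
      rfl
    simp only [inner_self_eq_norm_sq_to_K, Complex.coe_algebraMap] at h
    have h' : ‖j (L c v)‖ ^ 2 = ‖u‖ ^ 2 * ‖j v‖ ^ 2 - ‖j (L u v)‖ ^ 2 := by exact_mod_cast h
    refine abs_le_of_sq_le_sq' ?_ (by positivity) |>.2
    nlinarith [sq_nonneg ‖j (L c v)‖]
  choose π hπ using fun u => exists_clm_of_norm_le hj (j ∘ₗ L u) ‖u‖ (bound u)
  simp only [LinearMap.comp_apply] at hπ
  refine ⟨
    { toFun := π
      map_one' := clm_ext_of_dense hj fun v => by simp [hπ]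
      map_mul' := fun a b => clm_ext_of_dense hj fun v => by simp [hπ]
      map_zero' := clm_ext_of_dense hj fun v => by simp [hπ]
      map_add' := fun a b => clm_ext_of_dense hj fun v => by simp [hπ]
      commutes' := fun r => clm_ext_of_dense hj fun v => by
        simp [hπ, Algebra.algebraMap_eq_smul_one]
      map_star' := fun a => clm_ext_inner_of_dense hj fun v w => by
        rw [ContinuousLinearMap.star_eq_adjoint, ContinuousLinearMap.adjoint_inner_right, hπ, hπ,
          hL] }, hπ⟩

/-- A nonnegative form dominated by the inner product is represented by a positive operator,
namely `W⋆ W` for the contraction `W` into the Hilbert space of the smaller form. -/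
lemma exists_positive_of_form_le {E : Type u} [AddCommGroup E] [Module ℂ E]
    {j : E →ₗ[ℂ] K} (hj : DenseRange j)
    (B : E →ₗ⋆[ℂ] E →ₗ[ℂ] ℂ) (hB : ∀ v, 0 ≤ B v v) (hle : ∀ v, B v v ≤ ⟪j v, j v⟫_ℂ) :
    ∃ D : K →L[ℂ] K, 0 ≤ D ∧ ∀ v w, ⟪j v, D (j w)⟫_ℂ = B v w := by
  obtain ⟨F, _, _, _, k, -, hk⟩ := exists_hilbert_completion B hB
  have bound (v : E) : ‖k v‖ ≤ 1 * ‖j v‖ := by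
    have h := hle v
    rw [← hk, inner_self_eq_norm_sq_to_K, inner_self_eq_norm_sq_to_K] at h
    have h' : ‖k v‖ ^ 2 ≤ ‖j v‖ ^ 2 := by exact_mod_cast h
    simpa using (abs_le_of_sq_le_sq' h' (norm_nonneg _)).2
  obtain ⟨W, hW⟩ := exists_clm_of_norm_le hj k 1 bound
  refine ⟨W.adjoint ∘L W, (ContinuousLinearMap.nonneg_iff_isPositive _).2
    (ContinuousLinearMap.isPositive_adjoint_comp_self W), fun v w => ?_⟩
  rw [ContinuousLinearMap.comp_apply, ContinuousLinearMap.adjoint_inner_right, hW, hW, hk]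

end Dense

/-! ### Dilations -/

section Form

variable {A : Type*} [CStarAlgebra A] {H : Type*} [NormedAddCommGroup H] [InnerProductSpace ℂ H]

/-- The sesquilinear form `(x ⊗ ξ, y ⊗ η) ↦ ⟪ξ, Φ (x⋆ y) η⟫` on the algebraic tensor product
`A ⊗ H`. It is nonnegative exactly when `Φ` is completely positive. -/
noncomputable def dilationForm (Φ : A →ₗ[ℂ] (H →L[ℂ] H)) :
    (A ⊗[ℂ] H) →ₗ⋆[ℂ] (A ⊗[ℂ] H) →ₗ[ℂ] ℂ :=
  TensorProduct.lift <| LinearMap.mk₂'ₛₗ (starRingEnd ℂ) (starRingEnd ℂ)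
    (fun x ξ => TensorProduct.lift <| LinearMap.mk₂ ℂ (fun y η => ⟪ξ, Φ (star x * y) η⟫_ℂ)
      (by intros; simp [mul_add])
      (by intros; simp)
      (by intros; simp)
      (by intros; simp))
    (by intros; ext; simp [add_mul])
    (by intros; ext; simp)
    (by intros; ext; simp)
    (by intros; ext; simp [mul_comm])

@[simp]
lemma dilationForm_tmul (Φ : A →ₗ[ℂ] (H →L[ℂ] H)) (x y : A) (ξ η : H) :
    dilationForm Φ (x ⊗ₜ ξ) (y ⊗ₜ η) = ⟪ξ, Φ (star x * y) η⟫_ℂ := by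
  simp [dilationForm]

lemma sesq_tmul_induction {B B' : (A ⊗[ℂ] H) →ₗ⋆[ℂ] (A ⊗[ℂ] H) →ₗ[ℂ] ℂ}
    (h : ∀ x ξ y η, B (x ⊗ₜ ξ) (y ⊗ₜ η) = B' (x ⊗ₜ ξ) (y ⊗ₜ η)) : B = B' := by
  apply TensorProduct.ext'
  intro x ξ
  apply TensorProduct.ext'
  exact h x ξ

/-- The algebra acts on the first factor by operators adjointable for `dilationForm Φ`. -/
lemma dilationForm_rTensor (Φ : A →ₗ[ℂ] (H →L[ℂ] H)) (b : A) (v w : A ⊗[ℂ] H) :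
    dilationForm Φ ((LinearMap.mulLeft ℂ b).rTensor H v) w =
      dilationForm Φ v ((LinearMap.mulLeft ℂ (star b)).rTensor H w) := by
  have : dilationForm Φ ∘ₛₗ (LinearMap.mulLeft ℂ b).rTensor H =
      (dilationForm Φ).compl₂ ((LinearMap.mulLeft ℂ (star b)).rTensor H) :=
    sesq_tmul_induction fun x ξ y η => by simp [mul_assoc]
  exact congr($this v w)

/-- Operators whose adjoint commutes with the values of `Φ` act on the second factor by operators
adjointable for `dilationForm Φ`. -/
lemma dilationForm_lTensor [CompleteSpace H] (Φ : A →ₗ[ℂ] (H →L[ℂ] H)) (N : H →L[ℂ] H)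
    (hN : ∀ b, Commute (star N) (Φ b)) (v w : A ⊗[ℂ] H) :
    dilationForm Φ (N.toLinearMap.lTensor A v) w =
      dilationForm Φ v ((star N).toLinearMap.lTensor A w) := by
  have : dilationForm Φ ∘ₛₗ N.toLinearMap.lTensor A =
      (dilationForm Φ).compl₂ ((star N).toLinearMap.lTensor A) :=
    sesq_tmul_induction fun x ξ y η => by
      have := congr($((hN (star x * y)).eq) η)
      simp only [mul_apply_eq_comp, ContinuousLinearMap.star_eq_adjoint] at this
      suffices ⟪N ξ, Φ (star x * y) η⟫_ℂ = ⟪ξ, Φ (star x * y) (N.adjoint η)⟫_ℂ by simpa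
      rw [← this, ContinuousLinearMap.adjoint_inner_right]
  exact congr($this v w)

lemma dilationForm_sum {Y : Type*} [Fintype Y] (Φ₀ : A →ₗ[ℂ] (H →L[ℂ] H))
    (Φ : Y → A →ₗ[ℂ] (H →L[ℂ] H)) (h : ∀ b, ∑ y, Φ y b = Φ₀ b) (v w : A ⊗[ℂ] H) :
    ∑ y, dilationForm (Φ y) v w = dilationForm Φ₀ v w := by
  have : ∑ y, dilationForm (Φ y) = dilationForm Φ₀ := sesq_tmul_induction fun x ξ y η => by
    simp [LinearMap.sum_apply, ← h, ← inner_sum]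
  simp [← this, LinearMap.sum_apply]

end Form

/-- The operators commuting with all elements of `s` and their adjoints. The set `s` need not be
closed under adjoints. -/
noncomputable abbrev commutant {H : Type*} [NormedAddCommGroup H] [InnerProductSpace ℂ H]
    [CompleteSpace H] (s : Set (H →L[ℂ] H)) : StarSubalgebra ℂ (H →L[ℂ] H) :=
  StarSubalgebra.centralizer ℂ s

instance isClosed_commutant {H : Type*} [NormedAddCommGroup H] [InnerProductSpace ℂ H]
    [CompleteSpace H] (s : Set (H →L[ℂ] H)) : IsClosed (commutant s : Set (H →L[ℂ] H)) := by
  rw [StarSubalgebra.coe_centralizer]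
  exact Set.isClosed_centralizer _

lemma sqrt_mem_commutant {H : Type*} [NormedAddCommGroup H] [InnerProductSpace ℂ H]
    [CompleteSpace H] {s : Set (H →L[ℂ] H)} {T : H →L[ℂ] H} (hT : T ∈ commutant s) :
    CFC.sqrt T ∈ commutant s := by
  rw [StarSubalgebra.mem_centralizer_iff] at hT ⊢
  have h (g : H →L[ℂ] H) (hg : g * T = T * g) : g * CFC.sqrt T = CFC.sqrt T * g :=
    (Commute.cfcₙ_nnreal (show Commute T g from hg.symm) _).symm.eq
  exact fun g hg => ⟨h g (hT g hg).1, h _ (hT g hg).2⟩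

/-- A positive operator in a commutant is a square within the commutant: positivity does not depend
on the ambient algebra. -/
lemma exists_eq_star_mul_self_commutant {H : Type*} [NormedAddCommGroup H] [InnerProductSpace ℂ H]
    [CompleteSpace H] {s : Set (H →L[ℂ] H)} {T : H →L[ℂ] H} (hT : 0 ≤ T) (hs : T ∈ commutant s) :
    ∃ r : commutant s, (⟨T, hs⟩ : commutant s) = star r * r :=
  ⟨⟨CFC.sqrt T, sqrt_mem_commutant hs⟩, Subtype.ext <| by
    change T = star (CFC.sqrt T) * CFC.sqrt T
    rw [(CFC.sqrt_nonneg _).isSelfAdjoint.star_eq, CFC.sqrt_mul_sqrt_self _ hT]⟩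

/-- Forgetting continuity, as a homomorphism of algebras. -/
def clmToEnd {H : Type*} [NormedAddCommGroup H] [InnerProductSpace ℂ H] :
    (H →L[ℂ] H) →ₐ[ℂ] Module.End ℂ H where
  toFun T := T.toLinearMap
  map_one' := rfl
  map_mul' _ _ := rfl
  map_zero' := rfl
  map_add' _ _ := rfl
  commutes' _ := rfl

/-- Stinespring dilation `V⋆ π(b) V` of a unital completely positive map `Φ₀`, together with the
Radon–Nikodym derivatives `D x y` of its summands `Φ x y` and the lifting `ρ` of the operators that
commute with a set `s` containing all values of the maps involved. -/
lemma exists_dilation {A : Type u} [CStarAlgebra A] {H : Type v} [NormedAddCommGroup H]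
    [InnerProductSpace ℂ H] [CompleteSpace H] {X Y : Type*} [Fintype Y]
    (Φ₀ : A →ₗ[ℂ] (H →L[ℂ] H)) (Φ : X → Y → A →ₗ[ℂ] (H →L[ℂ] H))
    (hΦ₀ : ∀ v, 0 ≤ dilationForm Φ₀ v v) (hΦ : ∀ x y v, 0 ≤ dilationForm (Φ x y) v v)
    (hsum : ∀ x b, ∑ y, Φ x y b = Φ₀ b) (hone : Φ₀ 1 = 1)
    (s : Set (H →L[ℂ] H)) (hs₀ : ∀ b, Φ₀ b ∈ s) (hs : ∀ x y b, Φ x y b ∈ s) :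
    ∃ (K : Type (max u v)) (_ : NormedAddCommGroup K) (_ : InnerProductSpace ℂ K)
      (_ : CompleteSpace K) (V : H →ₗᵢ[ℂ] K) (π : A →⋆ₐ[ℂ] (K →L[ℂ] K))
      (ρ : commutant s →⋆ₐ[ℂ] (K →L[ℂ] K)) (D : X → Y → K →L[ℂ] K),
      (∀ x y, 0 ≤ D x y) ∧ (∀ x, ∑ y, D x y = 1) ∧
      (∀ x y b, Commute (D x y) (π b)) ∧ (∀ N b, Commute (ρ N) (π b)) ∧
      (∀ N x y, Commute (ρ N) (D x y)) ∧ (∀ N ξ, ρ N (V ξ) = V ((N : H →L[ℂ] H) ξ)) ∧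
      ∀ x y b ξ η, ⟪V ξ, D x y (π b (V η))⟫_ℂ = ⟪ξ, Φ x y b η⟫_ℂ := by
  obtain ⟨K, _, _, _, j, hj, hjB⟩ := exists_hilbert_completion (dilationForm Φ₀) hΦ₀
  obtain ⟨π, hπ⟩ := exists_starAlgHom_of_action hj
    ((Module.End.rTensorAlgHom ℂ A H).comp (Algebra.lmul ℂ A)) fun b v w => by
      rw [hjB, hjB]
      exact dilationForm_rTensor Φ₀ b v w
  have hcomm (N : commutant s) (T : H →L[ℂ] H) (hT : T ∈ s) :
      Commute (star (N : H →L[ℂ] H)) T :=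
    ((StarSubalgebra.mem_centralizer_iff ℂ).1 (star_mem N.2) T hT).1.symm
  obtain ⟨ρ, hρ⟩ := exists_starAlgHom_of_action hj
    ((Module.End.lTensorAlgHom ℂ H A).comp
      (clmToEnd.comp (commutant s).subtype.toAlgHom)) fun N v w => by
      rw [hjB, hjB]
      exact dilationForm_lTensor Φ₀ (N : H →L[ℂ] H) (fun b => hcomm N _ (hs₀ b)) v w
  have hπ' (b : A) (v : A ⊗[ℂ] H) : π b (j v) = j ((LinearMap.mulLeft ℂ b).rTensor H v) := hπ b v
  have hρ' (N : commutant s) (v : A ⊗[ℂ] H) :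
    ρ N (j v) = j ((N : H →L[ℂ] H).toLinearMap.lTensor A v) := hρ N v
  have hle (x : X) (y : Y) (v : A ⊗[ℂ] H) : dilationForm (Φ x y) v v ≤ ⟪j v, j v⟫_ℂ := by
    rw [hjB, ← dilationForm_sum Φ₀ (Φ x) (hsum x)]
    exact Finset.single_le_sum (f := fun y => dilationForm (Φ x y) v v)
      (fun y _ => hΦ x y v) (Finset.mem_univ y)
  choose D hD hDB using fun x y => exists_positive_of_form_le hj _ (hΦ x y) (hle x y)
  refine ⟨K, inferInstance, inferInstance, inferInstance,
    (j ∘ₗ TensorProduct.mk ℂ A H 1).isometryOfInner fun ξ η => by simp [hjB, hone],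
    π, ρ, D, hD, fun x => ?_, fun x y b => ?_, fun N b => ?_, fun N x y => ?_, fun N ξ => ?_,
    fun x y b ξ η => ?_⟩
  · refine clm_ext_inner_of_dense hj fun v w => ?_
    simp [hDB, dilationForm_sum Φ₀ (Φ x) (hsum x), hjB]
  · refine clm_ext_inner_of_dense hj fun v w => ?_
    rw [mul_apply_eq_comp, mul_apply_eq_comp, ← ContinuousLinearMap.adjoint_inner_left (π b),
      ← ContinuousLinearMap.star_eq_adjoint, ← map_star, hπ', hπ', hDB, hDB, dilationForm_rTensor,
      star_star]
  · refine clm_ext_of_dense hj fun v => ?_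
    rw [mul_apply_eq_comp, mul_apply_eq_comp, hπ', hρ', hρ', hπ',
      ← LinearMap.comp_apply (LinearMap.lTensor A _), LinearMap.lTensor_comp_rTensor,
      ← LinearMap.rTensor_comp_lTensor, LinearMap.comp_apply]
  · refine clm_ext_inner_of_dense hj fun v w => ?_
    rw [mul_apply_eq_comp, mul_apply_eq_comp, ← ContinuousLinearMap.adjoint_inner_left (ρ N),
      ← ContinuousLinearMap.star_eq_adjoint, ← map_star, hρ', hρ', hDB, hDB,
      dilationForm_lTensor _ _ fun b => hcomm _ _ (hs x y b)]
    simp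
  · simp [hρ']
  · simp [hπ', hDB]

section Positivity

variable {A : Type*} [CStarAlgebra A] {H : Type*} [NormedAddCommGroup H] [InnerProductSpace ℂ H]

lemma dilationForm_sum_tmul (Φ : A →ₗ[ℂ] (H →L[ℂ] H)) {k : ℕ} (x : Fin k → A) (ξ : Fin k → H) :
    dilationForm Φ (∑ i, x i ⊗ₜ ξ i) (∑ i, x i ⊗ₜ ξ i) =
      ∑ i, ∑ l, ⟪ξ i, Φ (star (x i) * x l) (ξ l)⟫_ℂ := by
  simp only [map_sum, LinearMap.sum_apply, dilationForm_tmul]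
  exact Finset.sum_comm

/-- Complete positivity in the sense of matrices gives a nonnegative form: the matrix with entries
`x i⋆ * x l` is positive, and so is its image under the amplification of `T`. -/
lemma dilationForm_nonneg_of_cp [CompleteSpace H] [PartialOrder A] [StarOrderedRing A]
    {A' : Type*} [CStarAlgebra A'] [PartialOrder A'] [StarOrderedRing A'] (T : A →CP A')
    (π : A' →⋆ₐ[ℂ] (H →L[ℂ] H)) (v : A ⊗[ℂ] H) :
    0 ≤ dilationForm (π.toAlgHom.toLinearMap ∘ₗ T.toLinearMap) v v := by
  obtain ⟨k, x, ξ, rfl⟩ := TensorProduct.exists_sum_tmul_eq v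
  rw [dilationForm_sum_tmul]
  have hM : 0 ≤ CStarMatrix.ofMatrix (Matrix.of fun i l : Fin k => star (x i) * x l) := by
    -- The matrix is `R⋆ R` for the matrix `R` with first row `x` and all other rows zero.
    convert star_mul_self_nonneg (CStarMatrix.ofMatrix (Matrix.of fun i l : Fin k =>
      if i.val = 0 then x l else 0)) using 1
    ext i l
    have : NeZero k := ⟨fun h => by subst h; exact i.elim0⟩
    have h0 (r : Fin k) : r.val = 0 ↔ r = 0 := by rw [← Fin.val_eq_zero_iff]
    simp [CStarMatrix.mul_apply, CStarMatrix.star_apply, h0]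
  -- A positive matrix over `A'` is a sum of matrices `S⋆ S`, whose forms are sums of squares.
  have key (N : CStarMatrix (Fin k) (Fin k) A') (hN : 0 ≤ N) :
      0 ≤ ∑ i, ∑ l, ⟪ξ i, π (N i l) (ξ l)⟫_ℂ := by
    rw [StarOrderedRing.nonneg_iff] at hN
    induction hN using AddSubmonoid.closure_induction with
    | zero => simp
    | add M N _ _ hM hN =>
      simpa [inner_add_right, Finset.sum_add_distrib] using add_nonneg hM hN
    | mem N hN =>
      obtain ⟨S, rfl⟩ := hN
      have : ∑ i, ∑ l, ⟪ξ i, π ((star S * S) i l) (ξ l)⟫_ℂ =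
          ∑ r, ⟪∑ i, π (S r i) (ξ i), ∑ i, π (S r i) (ξ i)⟫_ℂ := by
        simp only [sum_inner, inner_sum, CStarMatrix.mul_apply, CStarMatrix.star_apply, map_sum,
          map_mul, map_star, sum_apply, mul_apply_eq_comp, ContinuousLinearMap.star_eq_adjoint,
          ContinuousLinearMap.adjoint_inner_right]
        rw [Finset.sum_congr rfl fun i _ => Finset.sum_comm, Finset.sum_comm]
        exact Finset.sum_congr rfl fun r _ => Finset.sum_comm
      rw [this]
      exact Finset.sum_nonneg fun r _ => by
        rw [inner_self_eq_norm_sq_to_K]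
        positivity
  exact key _ (T.map_cstarMatrix_nonneg _ hM)

/-- Positive functionals are completely positive. -/
lemma dilationForm_nonneg_of_functional [PartialOrder A] [StarOrderedRing A] (φ : A →ₚ[ℂ] ℂ)
    (v : A ⊗[ℂ] ℂ) :
    0 ≤ dilationForm ((Algebra.linearMap ℂ (ℂ →L[ℂ] ℂ)) ∘ₗ φ.toLinearMap) v v := by
  obtain ⟨k, x, ξ, rfl⟩ := TensorProduct.exists_sum_tmul_eq v
  rw [dilationForm_sum_tmul]
  have : ∑ i, ∑ l, ⟪ξ i, (Algebra.linearMap ℂ (ℂ →L[ℂ] ℂ) ∘ₗ φ.toLinearMap)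
      (star (x i) * x l) (ξ l)⟫_ℂ = φ (star (∑ i, ξ i • x i) * ∑ i, ξ i • x i) := by
    simp [star_sum, Finset.sum_mul_sum, map_sum, Algebra.algebraMap_eq_smul_one]
    refine Finset.sum_congr rfl fun i _ => Finset.sum_congr rfl fun l _ => ?_
    ring
  rw [this]
  exact map_nonneg φ (star_mul_self_nonneg _)

end Positivity

/-! ### From sequential to commuting-operator strategies -/

namespace SequentialStrategy

variable {n : ℕ} {I : Fin (n + 2) → Type v} {O : Fin (n + 2) → Type w} [∀ i, Fintype (O i)]

lemma effect_last (S : SequentialStrategy.{u} I O) (x : ∀ i, I i) (a : ∀ i, O i) :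
    S.effect x a (Fin.last n) = S.m (x (Fin.last (n + 1))) (a (Fin.last (n + 1))) := by
  simp [effect]

lemma effect_castSucc (S : SequentialStrategy.{u} I O) (x : ∀ i, I i) (a : ∀ i, O i) (j : Fin n) :
    S.effect x a j.castSucc =
      S.T j (x j.succ.castSucc) (a j.succ.castSucc) (S.effect x a j.succ) := by
  simp [effect]

/-- A realization of the first players of a sequential strategy, up to player `i`, by commuting
measurement operators on a Hilbert space, which moreover commute with a representation of the
algebra passed on to the remaining players. The operators `M k` of the players `k > i` carry no
information; they are only required to be positive and to commute with the others, so that `0`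
is a possible choice. The last field expresses the values of the strategy by the product of
the operators of the players up to `i`. -/
structure PartialRealization (S : SequentialStrategy.{u} I O) (i : Fin (n + 1)) where
  /-- the Hilbert space -/
  H : Type u
  [normedAddCommGroup : NormedAddCommGroup H]
  [innerProductSpace : InnerProductSpace ℂ H]
  [completeSpace : CompleteSpace H]
  /-- the representation of the algebra passed on to the following players -/
  π : S.𝒜 i →⋆ₐ[ℂ] (H →L[ℂ] H)
  /-- the measurement operators -/
  M : ∀ k, I k → O k → (H →L[ℂ] H)
  M_nonneg : ∀ k x a, 0 ≤ M k x a
  M_sum : ∀ k ≤ i.castSucc, ∀ x, ∑ a, M k x a = 1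
  M_comm : ∀ k l, k ≠ l → ∀ x a y b, Commute (M k x a) (M l y b)
  M_comm_π : ∀ k x a g, Commute (M k x a) (π g)
  /-- the state vector -/
  ψ : H
  norm_ψ : ‖ψ‖ = 1
  value_eq : ∀ x a, ⟪ψ, Fin.partialProd (fun k => M k (x k) (a k)) i.castSucc.succ
    (π (S.effect x a i) ψ)⟫_ℂ = S.value x a

attribute [instance] PartialRealization.normedAddCommGroup PartialRealization.innerProductSpace
  PartialRealization.completeSpace

end SequentialStrategy

/-! ### Ordered products, and families extended by one more player -/

lemma partialProd_congr {m : ℕ} {R : Type*} [Monoid R] {f g : Fin m → R} {i : Fin (m + 1)}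
    (h : ∀ k : Fin m, k.castSucc < i → f k = g k) : Fin.partialProd f i = Fin.partialProd g i := by
  induction i using Fin.induction with
  | zero => simp
  | succ i ih =>
    rw [Fin.partialProd_succ, Fin.partialProd_succ, h i i.castSucc_lt_succ,
      ih fun k hk => h k (hk.trans i.castSucc_lt_succ)]

lemma map_partialProd {m : ℕ} {R R' F : Type*} [Monoid R] [Monoid R'] [FunLike F R R']
    [MonoidHomClass F R R'] (φ : F) (f : Fin m → R) (i : Fin (m + 1)) :
    φ (Fin.partialProd f i) = Fin.partialProd (fun k => φ (f k)) i := by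
  induction i using Fin.induction with
  | zero => simp
  | succ i ih => simp [Fin.partialProd_succ, ih]

section AddPlayer

variable {m : ℕ} {I : Fin m → Type v} {O : Fin m → Type w} {R : Type*}

lemma update_commute [Mul R] {M : ∀ k, I k → O k → R} {c : Fin m} {D : I c → O c → R}
    (hM : ∀ k l, k ≠ l → ∀ x a y b, Commute (M k x a) (M l y b))
    (hD : ∀ k x a y b, Commute (M k x a) (D y b)) (k l : Fin m) (hkl : k ≠ l)
    (x : I k) (a : O k) (y : I l) (b : O l) :
    Commute (Function.update M c D k x a) (Function.update M c D l y b) := by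
  rcases eq_or_ne k c with rfl | hk
  · rw [Function.update_self, Function.update_of_ne hkl.symm]
    exact (hD _ _ _ _ _).symm
  · rw [Function.update_of_ne hk]
    rcases eq_or_ne l c with rfl | hl
    · rw [Function.update_self]
      exact hD _ _ _ _ _
    · rw [Function.update_of_ne hl]
      exact hM _ _ hkl _ _ _ _

lemma forall_update {M : ∀ k, I k → O k → R} {c : Fin m} {D : I c → O c → R} {p : R → Prop}
    (hM : ∀ k x a, p (M k x a)) (hD : ∀ x a, p (D x a)) (k : Fin m) (x : I k) (a : O k) :
    p (Function.update M c D k x a) := by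
  rcases eq_or_ne k c with rfl | hk
  · rw [Function.update_self]
    exact hD x a
  · rw [Function.update_of_ne hk]
    exact hM k x a

lemma partialProd_update [Monoid R] (M : ∀ k, I k → O k → R) (c : Fin m) (D : I c → O c → R)
    (x : ∀ k, I k) (a : ∀ k, O k) :
    Fin.partialProd (fun k => Function.update M c D k (x k) (a k)) c.succ =
      Fin.partialProd (fun k => M k (x k) (a k)) c.castSucc * D (x c) (a c) := by
  rw [Fin.partialProd_succ, Function.update_self]
  congr 1
  refine partialProd_congr fun k hk => ?_
  rw [Function.update_of_ne (Fin.castSucc_lt_castSucc_iff.1 hk).ne]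

lemma partialProd_update_last [Monoid R] {I : Fin (m + 1) → Type v} {O : Fin (m + 1) → Type w}
    (M : ∀ k, I k → O k → R) (D : I (Fin.last m) → O (Fin.last m) → R)
    (x : ∀ k, I k) (a : ∀ k, O k) :
    Fin.partialProd (fun k => Function.update M (Fin.last m) D k (x k) (a k)) (Fin.last (m + 1)) =
      Fin.partialProd (fun k => M k (x k) (a k)) (Fin.last m).castSucc *
        D (x (Fin.last m)) (a (Fin.last m)) :=
  partialProd_update M (Fin.last m) D x a

lemma sum_update [AddCommMonoid R] [One R] [∀ k, Fintype (O k)] {M : ∀ k, I k → O k → R}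
    {c : Fin m} {D : I c → O c → R} (hM : ∀ k < c, ∀ x, ∑ a, M k x a = 1)
    (hD : ∀ x, ∑ a, D x a = 1)
    (k : Fin m) (hk : k ≤ c) (x : I k) : ∑ a, Function.update M c D k x a = 1 := by
  rcases hk.eq_or_lt with rfl | hk
  · simpa using hD x
  · simpa [Function.update_of_ne hk.ne] using hM k hk x

end AddPlayer

/-! ### Realizing the players one after the other -/

namespace SequentialStrategy

variable {n : ℕ} {I : Fin (n + 2) → Type v} {O : Fin (n + 2) → Type w} [∀ i, Fintype (O i)]

/-- The GNS representation of the state of the first player, seen as a dilation over `H = ℂ`. -/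
lemma nonempty_partialRealization_zero (S : SequentialStrategy.{u} I O)
    (hS : S.IsOpNonSignallingAssemblage) : Nonempty (S.PartialRealization 0) := by
  obtain ⟨φ₀, hφ₀, hsum⟩ := hS
  obtain ⟨K, _, _, _, V, π, -, D, hDpos, hDsum, hDπ, -, -, -, hD⟩ :=
    exists_dilation (Algebra.linearMap ℂ (ℂ →L[ℂ] ℂ) ∘ₗ φ₀.toLinearMap)
      (fun x a => Algebra.linearMap ℂ (ℂ →L[ℂ] ℂ) ∘ₗ (S.φ x a).toLinearMap)
      (dilationForm_nonneg_of_functional φ₀)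
      (fun x a => dilationForm_nonneg_of_functional (S.φ x a))
      (fun x g => (map_sum _ _ _).symm.trans congr(Algebra.linearMap ℂ (ℂ →L[ℂ] ℂ) $(hsum x g)))
      ((congrArg (Algebra.linearMap ℂ (ℂ →L[ℂ] ℂ)) hφ₀).trans (by simp))
      Set.univ (fun _ => trivial) (fun _ _ _ => trivial)
  refine ⟨{
    H := K
    π := π
    M := Function.update (fun _ _ _ => 0) 0 D
    M_nonneg := forall_update (by simp) hDpos
    M_sum := sum_update (by simp) hDsum
    M_comm := update_commute (by simp) (by simp)
    M_comm_π := fun k x a g => forall_update (p := fun T => Commute T (π g)) (by simp)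
      (fun x a => hDπ x a g) k x a
    ψ := V 1
    norm_ψ := by simp
    value_eq := fun x a => ?_ }⟩
  have h := hD (x 0) (a 0) (S.effect x a 0) 1 1
  refine ((congrArg (fun W : K →L[ℂ] K => ⟪V 1, W (π (S.effect x a 0) (V 1))⟫_ℂ)
    ((partialProd_update _ 0 D x a).trans (by simp))).trans h).trans ?_
  simp [value]

/-- One step: dilate the next player's maps, composed with the representation at hand, and lift the
operators of the players before. -/
lemma nonempty_partialRealization_succ (S : SequentialStrategy.{u} I O) (j : Fin n)
    (hS : S.IsOpNonSignallingTransformation j) (R : S.PartialRealization j.castSucc) :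
    Nonempty (S.PartialRealization j.succ) := by
  obtain ⟨T₀, hT₀, hsum⟩ := hS
  obtain ⟨K, _, _, _, V, π, ρ, D, hDpos, hDsum, hDπ, hρπ, hρD, hρV, hD⟩ :=
    exists_dilation (R.π.toAlgHom.toLinearMap ∘ₗ T₀.toLinearMap)
      (fun x a => R.π.toAlgHom.toLinearMap ∘ₗ (S.T j x a).toLinearMap)
      (dilationForm_nonneg_of_cp T₀ R.π)
      (fun x a => dilationForm_nonneg_of_cp (S.T j x a) R.π)
      (fun x g => (map_sum R.π _ _).symm.trans congr(R.π $(hsum x g)))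
      ((congrArg R.π hT₀).trans (map_one _))
      (Set.range R.π) (fun _ => ⟨_, rfl⟩) (fun _ _ _ => ⟨_, rfl⟩)
  have hmem (k) (x : I k) (a : O k) : R.M k x a ∈ commutant (Set.range R.π) := by
    rw [StarSubalgebra.mem_centralizer_iff]
    rintro _ ⟨g, rfl⟩
    rw [← map_star]
    exact ⟨(R.M_comm_π k x a g).symm.eq, (R.M_comm_π k x a _).symm.eq⟩
  let N (k) (x : I k) (a : O k) : commutant (Set.range R.π) := ⟨R.M k x a, hmem k x a⟩
  have hNpos (k) (x : I k) (a : O k) : 0 ≤ ρ (N k x a) := by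
    obtain ⟨r, hr⟩ := exists_eq_star_mul_self_commutant (R.M_nonneg k x a) (hmem k x a)
    change 0 ≤ ρ ⟨R.M k x a, hmem k x a⟩
    rw [hr, map_mul, map_star]
    exact star_mul_self_nonneg _
  refine ⟨{
    H := K
    π := π
    M := Function.update (fun k x a => ρ (N k x a)) j.succ.castSucc D
    M_nonneg := forall_update hNpos hDpos
    M_sum := sum_update (fun k hk x => by
      have : ∑ a, N k x a = 1 := Subtype.ext <| by
        simpa [N] using R.M_sum k (Fin.le_castSucc_iff.2 hk) x
      rw [← map_sum, this, map_one]) hDsum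
    M_comm := update_commute
      (fun k l hkl x a y b => Commute.map
        (show Commute (N k x a) (N l y b) from Subtype.ext (R.M_comm k l hkl x a y b).eq) ρ)
      (fun k x a y b => hρD _ _ _)
    M_comm_π := fun k x a g => forall_update (p := fun T => Commute T (π g))
      (fun k x a => hρπ _ _) (fun x a => hDπ x a g) k x a
    ψ := V R.ψ
    norm_ψ := by simp [R.norm_ψ]
    value_eq := fun x a => ?_ }⟩
  set W := Fin.partialProd (fun k => N k (x k) (a k)) j.succ.castSucc.castSucc with hW
  have hWR : (W : R.H →L[ℂ] R.H) =
      Fin.partialProd (fun k => R.M k (x k) (a k)) j.castSucc.castSucc.succ :=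
    map_partialProd (commutant (Set.range R.π)).subtype _ _
  -- The lifted product moves to the other side, where `ρ W⋆ ∘ V = V ∘ W⋆`; then `V` cancels.
  rw [partialProd_update, ← map_partialProd ρ, ← hW, mul_apply_eq_comp,
    ← ContinuousLinearMap.adjoint_inner_left (ρ W), ← ContinuousLinearMap.star_eq_adjoint,
    ← map_star, hρV, hD, ← R.value_eq x a, ← hWR, S.effect_castSucc]
  simp [ContinuousLinearMap.star_eq_adjoint, ContinuousLinearMap.adjoint_inner_left]
  rfl

lemma nonempty_partialRealization (S : SequentialStrategy.{u} I O) (hS : S.IsOpNonSignalling)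
    (i : Fin (n + 1)) : Nonempty (S.PartialRealization i) := by
  induction i using Fin.induction with
  | zero => exact S.nonempty_partialRealization_zero hS.1
  | succ j ih => exact ih.elim (S.nonempty_partialRealization_succ j (hS.2 j))

end SequentialStrategy

lemma CommutingStrategy.value_eq_partialProd {n : ℕ} {I : Fin (n + 2) → Type v}
    {O : Fin (n + 2) → Type w} [∀ i, Fintype (O i)] (S : CommutingStrategy.{u} I O)
    (x : ∀ i, I i) (a : ∀ i, O i) :
    S.value x a =
      ⟪S.ψ, Fin.partialProd (fun i => S.M i (x i) (a i)) (Fin.last (n + 2)) S.ψ⟫_ℂ := by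
  rw [value, Fin.partialProd, List.take_of_length_le (by simp)]

/-- A realization of all players but the last becomes a commuting-operator strategy when the last
player measures the represented elements `S.m`. -/
noncomputable def SequentialStrategy.PartialRealization.toCommuting {n : ℕ}
    {I : Fin (n + 2) → Type v} {O : Fin (n + 2) → Type w} [∀ i, Fintype (O i)]
    {S : SequentialStrategy.{u} I O} (R : S.PartialRealization (Fin.last n)) :
    CommutingStrategy.{u} I O where
  H := R.H
  M := Function.update R.M (Fin.last (n + 1)) fun x a => R.π (S.m x a)
  M_pos := forall_update (p := ContinuousLinearMap.IsPositive)
    (fun k x a => (ContinuousLinearMap.nonneg_iff_isPositive _).1 (R.M_nonneg k x a))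
    fun x a => (ContinuousLinearMap.nonneg_iff_isPositive _).1 (map_nonneg R.π (S.m_nonneg x a))
  M_sum k := sum_update
    (fun k hk => R.M_sum k (Nat.le_of_lt_succ (Fin.lt_def.1 hk)))
    (fun x => by rw [← map_sum, S.m_sum, map_one]) k (Fin.le_last k)
  M_comm := update_commute R.M_comm fun k x a y b => R.M_comm_π _ _ _ _
  ψ := R.ψ
  norm_ψ := R.norm_ψ

lemma SequentialStrategy.PartialRealization.value_toCommuting {n : ℕ}
    {I : Fin (n + 2) → Type v} {O : Fin (n + 2) → Type w} [∀ i, Fintype (O i)]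
    {S : SequentialStrategy.{u} I O} (R : S.PartialRealization (Fin.last n))
    (x : ∀ i, I i) (a : ∀ i, O i) : R.toCommuting.value x a = S.value x a := by
  have h := partialProd_update_last R.M (fun x a => R.π (S.m x a)) x a
  have h' := R.value_eq x a
  rw [S.effect_last] at h'
  rw [CommutingStrategy.value_eq_partialProd]
  refine (congrArg (fun W : R.H →L[ℂ] R.H => ⟪R.ψ, W R.ψ⟫_ℂ) h).trans ?_
  exact h'

theorem seqOpNSCorrelations_subset {n : ℕ} (I : Fin (n + 2) → Type v) (O : Fin (n + 2) → Type w)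
    [∀ i, Fintype (O i)] :
    seqOpNSCorrelations.{u} I O ⊆ commutingCorrelations.{u} I O := by
  rintro p ⟨S, hS, hp⟩
  obtain ⟨R⟩ := S.nonempty_partialRealization hS (Fin.last n)
  exact ⟨R.toCommuting, fun x a => (hp x a).trans (R.value_toCommuting x a).symm⟩

/-! ### From commuting-operator to sequential strategies -/

section Maps

variable {A B : Type*} [CStarAlgebra A] [PartialOrder A] [StarOrderedRing A]
  [CStarAlgebra B] [PartialOrder B] [StarOrderedRing B]

/-- The completely positive map `x ↦ s⋆ f(x) s` for a star homomorphism `f`. -/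
noncomputable def conjCP (f : A →⋆ₐ[ℂ] B) (s : B) : A →CP B where
  toLinearMap := LinearMap.mulLeftRight ℂ (star s, s) ∘ₗ f.toAlgHom.toLinearMap
  map_cstarMatrix_nonneg' k M hM := by
    rw [StarOrderedRing.nonneg_iff] at hM
    induction hM using AddSubmonoid.closure_induction with
    | zero => exact le_of_eq (by ext; simp)
    | add M N _ _ hM hN => exact (add_nonneg hM hN).trans_eq (by ext; simp [mul_add, add_mul])
    | mem N hN =>
      obtain ⟨S, rfl⟩ := hN
      convert star_mul_self_nonneg
        (CStarMatrix.ofMatrix (Matrix.of fun i l : Fin k => f (S i l) * s))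
      ext i l
      simp [CStarMatrix.mul_apply, CStarMatrix.star_apply, mul_assoc, ← map_star f]

lemma conjCP_apply (f : A →⋆ₐ[ℂ] B) (s : B) (x : A) : conjCP f s x = star s * f x * s := rfl

/-- The positive functional `x ↦ ⟪ξ, f(x) ξ⟫` for a representation `f`. -/
noncomputable def vectorFunctional {H : Type*} [NormedAddCommGroup H] [InnerProductSpace ℂ H]
    [CompleteSpace H] (f : A →⋆ₐ[ℂ] (H →L[ℂ] H)) (ξ : H) : A →ₚ[ℂ] ℂ :=
  PositiveLinearMap.mk₀
    { toFun := fun x => ⟪ξ, f x ξ⟫_ℂ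
      map_add' := fun x y => by simp
      map_smul' := fun r x => by simp }
    fun x hx =>
      ((ContinuousLinearMap.nonneg_iff_isPositive _).1 (map_nonneg f hx)).inner_nonneg_right ξ

lemma vectorFunctional_apply {H : Type*} [NormedAddCommGroup H] [InnerProductSpace ℂ H]
    [CompleteSpace H] (f : A →⋆ₐ[ℂ] (H →L[ℂ] H)) (ξ : H) (x : A) :
    vectorFunctional f ξ x = ⟪ξ, f x ξ⟫_ℂ := rfl

end Maps

section CommutantOrder

variable {H : Type*} [NormedAddCommGroup H] [InnerProductSpace ℂ H] [CompleteSpace H]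

/-- The order inherited from the bounded operators is the order of the commutant as a C*-algebra. -/
instance commutantStarOrderedRing (s : Set (H →L[ℂ] H)) : StarOrderedRing (commutant s) :=
  .of_nonneg_iff' (fun {x y} h z => add_le_add_right (α := H →L[ℂ] H) h z) fun x =>
    ⟨fun hx => exists_eq_star_mul_self_commutant hx x.2, by
      rintro ⟨r, rfl⟩
      exact star_mul_self_nonneg (r : H →L[ℂ] H)⟩

end CommutantOrder

lemma sqrt_mul_mul_sqrt {H : Type*} [NormedAddCommGroup H] [InnerProductSpace ℂ H]
    [CompleteSpace H] {M X : H →L[ℂ] H} (hM : 0 ≤ M) (h : Commute M X) :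
    star (CFC.sqrt M) * X * CFC.sqrt M = M * X := by
  have hs : Commute (CFC.sqrt M) X := Commute.cfcₙ_nnreal h _
  rw [(CFC.sqrt_nonneg M).isSelfAdjoint.star_eq, mul_assoc, ← hs.eq, ← mul_assoc,
    CFC.sqrt_mul_sqrt_self _ hM]

namespace CommutingStrategy

variable {n : ℕ} {I : Fin (n + 2) → Type v} {O : Fin (n + 2) → Type w} [∀ i, Fintype (O i)]

lemma M_nonneg (S : CommutingStrategy.{u} I O) (i x a) : 0 ≤ S.M i x a :=
  (ContinuousLinearMap.nonneg_iff_isPositive _).2 (S.M_pos i x a)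

/-- The measurement operators of the players up to `i`. -/
def firstOperators (S : CommutingStrategy.{u} I O) (i : Fin (n + 1)) : Set (S.H →L[ℂ] S.H) :=
  {T | ∃ k ≤ i.castSucc, ∃ x a, S.M k x a = T}

lemma M_mem_commutant (S : CommutingStrategy.{u} I O) {i : Fin (n + 1)} {k : Fin (n + 2)}
    (hk : i.castSucc < k) (x : I k) (a : O k) : S.M k x a ∈ commutant (S.firstOperators i) := by
  rw [StarSubalgebra.mem_centralizer_iff]
  rintro _ ⟨l, hl, y, b, rfl⟩
  rw [(S.M_nonneg l y b).isSelfAdjoint.star_eq, and_self]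
  exact S.M_comm l k (hl.trans_lt hk).ne _ _ _ _

lemma commute_of_mem_commutant (S : CommutingStrategy.{u} I O) {i : Fin (n + 1)} {k : Fin (n + 2)}
    (hk : k ≤ i.castSucc) (x : I k) (a : O k) (X : commutant (S.firstOperators i)) :
    Commute (S.M k x a) (X : S.H →L[ℂ] S.H) :=
  ((StarSubalgebra.mem_centralizer_iff ℂ).1 X.2 _ ⟨k, hk, x, a, rfl⟩).1

/-- The inclusion of the commutant of more players into the commutant of fewer. -/
noncomputable def incl (S : CommutingStrategy.{u} I O) (j : Fin n) :
    commutant (S.firstOperators j.succ) →⋆ₐ[ℂ] commutant (S.firstOperators j.castSucc) :=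
  StarSubalgebra.inclusion <| StarSubalgebra.centralizer_le ℂ _ _ <| by
    rintro _ ⟨k, hk, h⟩
    exact ⟨k, hk.trans (by rw [Fin.le_def]; simp), h⟩

@[simp]
lemma coe_incl (S : CommutingStrategy.{u} I O) (j : Fin n)
    (X : commutant (S.firstOperators j.succ)) : (S.incl j X : S.H →L[ℂ] S.H) = X := rfl

lemma castSucc_castSucc_lt (j : Fin n) : j.castSucc.castSucc < j.succ.castSucc := by
  rw [Fin.lt_def]; simp

/-- The square root of a measurement operator of the intermediate player `j + 1`, as an element of
the commutant of the players before. -/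
noncomputable def sqrtM (S : CommutingStrategy.{u} I O) (j : Fin n) (x : I j.succ.castSucc)
    (a : O j.succ.castSucc) : commutant (S.firstOperators j.castSucc) :=
  ⟨CFC.sqrt (S.M _ x a), sqrt_mem_commutant (S.M_mem_commutant (castSucc_castSucc_lt j) x a)⟩

lemma coe_conjCP_sqrtM (S : CommutingStrategy.{u} I O) (j : Fin n) (x : I j.succ.castSucc)
    (a : O j.succ.castSucc) (X : commutant (S.firstOperators j.succ)) :
    (conjCP (S.incl j) (S.sqrtM j x a) X : S.H →L[ℂ] S.H) = S.M _ x a * X :=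
  sqrt_mul_mul_sqrt (S.M_nonneg _ x a) (S.commute_of_mem_commutant le_rfl x a X)

lemma sum_conjCP_sqrtM (S : CommutingStrategy.{u} I O) (j : Fin n) (x : I j.succ.castSucc)
    (X : commutant (S.firstOperators j.succ)) :
    ∑ a, conjCP (S.incl j) (S.sqrtM j x a) X = S.incl j X := by
  apply Subtype.ext
  rw [AddSubmonoidClass.coe_finsetSum]
  simp only [coe_conjCP_sqrtM, ← Finset.sum_mul, S.M_sum, one_mul, coe_incl]

lemma vectorFunctional_sqrt (S : CommutingStrategy.{u} I O) (x : I 0) (a : O 0)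
    (X : commutant (S.firstOperators 0)) :
    vectorFunctional (commutant (S.firstOperators 0)).subtype (CFC.sqrt (S.M 0 x a) S.ψ) X =
      ⟪S.ψ, S.M 0 x a ((X : S.H →L[ℂ] S.H) S.ψ)⟫_ℂ := by
  rw [vectorFunctional_apply, ← ContinuousLinearMap.adjoint_inner_right,
    ← ContinuousLinearMap.star_eq_adjoint]
  exact congr(⟪S.ψ, $(sqrt_mul_mul_sqrt (S.M_nonneg 0 x a)
    (S.commute_of_mem_commutant (k := 0) (Fin.zero_le _) x a X)) S.ψ⟫_ℂ)

lemma vectorFunctional_ψ_one (S : CommutingStrategy.{u} I O) (i : Fin (n + 1)) :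
    vectorFunctional (commutant (S.firstOperators i)).subtype S.ψ 1 = 1 := by
  rw [vectorFunctional_apply, map_one, one_apply_eq_self]
  simp [S.norm_ψ]

lemma sum_vectorFunctional_sqrt (S : CommutingStrategy.{u} I O) (x : I 0)
    (X : commutant (S.firstOperators 0)) :
    ∑ a, vectorFunctional (commutant (S.firstOperators 0)).subtype (CFC.sqrt (S.M 0 x a) S.ψ) X =
      vectorFunctional (commutant (S.firstOperators 0)).subtype S.ψ X := by
  simp only [vectorFunctional_sqrt, ← inner_sum, ← sum_apply, S.M_sum]
  rfl

/-- The sequential strategy of a commuting-operator strategy: the algebras are the commutants of the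
operators of the players that have already acted. -/
noncomputable abbrev toSequential (S : CommutingStrategy.{u} I O) : SequentialStrategy.{u} I O where
  𝒜 i := commutant (S.firstOperators i)
  φ x a := vectorFunctional (commutant (S.firstOperators 0)).subtype (CFC.sqrt (S.M 0 x a) S.ψ)
  φ_sum_one x := by
    rw [sum_vectorFunctional_sqrt, vectorFunctional_ψ_one]
  T j x a := conjCP (S.incl j) (S.sqrtM j x a)
  T_sum_one j x := by rw [sum_conjCP_sqrtM, map_one]
  m x a := ⟨S.M _ x a, S.M_mem_commutant (Fin.castSucc_lt_last _) x a⟩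
  m_nonneg x a := S.M_nonneg _ x a
  m_sum x := Subtype.ext <| by simpa using S.M_sum _ x

lemma toSequential_isOpNonSignalling (S : CommutingStrategy.{u} I O) :
    S.toSequential.IsOpNonSignalling :=
  have h (j) (X : commutant (S.firstOperators (Fin.succ j))) :
      conjCP (S.incl j) 1 X = S.incl j X := by simp [conjCP_apply]
  ⟨⟨vectorFunctional (commutant (S.firstOperators 0)).subtype S.ψ, S.vectorFunctional_ψ_one 0,
    S.sum_vectorFunctional_sqrt⟩, fun j => ⟨conjCP (S.incl j) 1, (h j 1).trans (map_one _),
      fun x X => (S.sum_conjCP_sqrtM j x X).trans (h j X).symm⟩⟩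

/-- The operator underlying an element of one of the commutants. -/
abbrev toOperator (S : CommutingStrategy.{u} I O) {i : Fin (n + 1)} (X : S.toSequential.𝒜 i) :
    S.H →L[ℂ] S.H :=
  Subtype.val (p := (· ∈ commutant (S.firstOperators i))) X

/-- The operators of the players up to `i`, multiplied by the effect of the remaining players, give
the full product, whichever `i` is. -/
lemma partialProd_mul_effect (S : CommutingStrategy.{u} I O) (x : ∀ i, I i) (a : ∀ i, O i)
    (i : Fin (n + 1)) :
    Fin.partialProd (fun k => S.M k (x k) (a k)) i.castSucc.succ *
        S.toOperator (S.toSequential.effect x a i) =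
      Fin.partialProd (fun k => S.M k (x k) (a k)) (Fin.last (n + 2)) := by
  induction i using Fin.reverseInduction with
  | last =>
    rw [SequentialStrategy.effect_last]
    exact (Fin.partialProd_succ _ (Fin.last (n + 1))).symm
  | cast j ih =>
    rw [← ih, SequentialStrategy.effect_castSucc, Fin.partialProd_succ _ j.succ.castSucc, mul_assoc]
    exact congrArg _ (S.coe_conjCP_sqrtM _ _ _ _)

lemma value_toSequential (S : CommutingStrategy.{u} I O) (x : ∀ i, I i) (a : ∀ i, O i) :
    S.toSequential.value x a = S.value x a := by
  rw [value_eq_partialProd, ← S.partialProd_mul_effect x a 0]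
  refine (S.vectorFunctional_sqrt (x 0) (a 0) _).trans ?_
  have : Fin.partialProd (fun k => S.M k (x k) (a k)) (Fin.castSucc (0 : Fin (n + 1))).succ =
    S.M 0 (x 0) (a 0) := by
    rw [Fin.partialProd_succ]
    simp
  rw [this]
  rfl

end CommutingStrategy

theorem commutingCorrelations_subset {n : ℕ} (I : Fin (n + 2) → Type v) (O : Fin (n + 2) → Type w)
    [∀ i, Fintype (O i)] :
    commutingCorrelations.{u} I O ⊆ seqOpNSCorrelations.{u} I O := by
  rintro p ⟨S, hp⟩
  exact ⟨S.toSequential, S.toSequential_isOpNonSignalling, fun x a => by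
    rw [hp, S.value_toSequential]⟩

end SeqGames

theorem mainTheorem3 (n : ℕ) (I : Fin (n + 2) → Type v) (O : Fin (n + 2) → Type w)
    [∀ i, Fintype (I i)] [∀ i, Fintype (O i)] :
    SeqGames.seqOpNSCorrelations.{u} I O = SeqGames.commutingCorrelations.{u} I O :=
  (SeqGames.seqOpNSCorrelations_subset I O).antisymm (SeqGames.commutingCorrelations_subset I O)
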